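/- Let $n\ge 0$, let $e_{-n},\dots,e_n$ be the standard basis of $\mathbb C^{2n+1}$, and let $W=\Lambda^n\mathbb C^{2n+1}$ and $\mathcal T=\Lambda^{2n}\mathbb C^{2n+1}$ be the spaces of skew-symmetric tensors with $n$ and with $2n$ indices. For a list $I=(i_1,\dots,i_k)$ put $e_I=e_{i_1}\wedge\dots\wedge e_{i_k}$ and $-I=(-i_1,\dots,-i_k)$. **The data of $\mathcal T$.** Let $\rho:\mathcal T\to\mathrm{End}(W)$ be the linear map with $$\rho(e_{a_1}\wedge\dots\wedge e_{a_n}\wedge e_{b_1}\wedge\dots\wedge e_{b_n})(e_{-b_1}\wedge\dots\wedge e_{-b_n})=e_{a_1}\wedge\dots\wedge e_{a_n}$$ for distinct $a_1,\dots,a_n,b_1,\dots,b_n$, and $\rho(e_I)e_R=0$ if $-R\not\subset I$. Let $\sigma$ be the involution $\sigma(e_I)=e_{-I}$ of $\mathcal T$, and let $\langle\cdot,\cdot\rangle$ be the symmetric bilinear form on $\mathcal T$ with $\langle e_I,e_{-I}\rangle=1$ and $\langle e_I,e_{-J}\rangle=0$ for distinct $2n$-element subsets $I\neq J$ of $\{-n,\dots,n\}$.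 For a basis $(I_s)$ of $\mathcal T$ with dual basis $(I_s^*)$, $\langle I_s,I_t^*\rangle=\delta_{st}$, define operators on $W^{\otimes m}$ by $$\tau_{ij}=\sum_s\rho(I_s)^{(i)}\rho(I_s^*)^{(j)},\quad \mu_{ij}=\sum_s\rho(I_s)^{(i)}\rho(\sigma(I_s^*))^{(j)},\quad \nu_i=\tfrac12\sum_s\bigl(\rho(I_s)\rho(\sigma(I_s^*))+\rho(I_s)\rho(I_s^*)\bigr)^{(i)},$$ where $A^{(i)}$ is $A$ acting on the $i$-th tensor factor and $i\ne j$. (For an orthonormal basis the last term of $\nu_i$ is $\rho(I_s)^2$.) **The Pfaffians.** Let $\mathfrak o_{2n+1}$ be the Lie algebra of complex matrices, with rows and columns indexed by $-n,\dots,n$, that preserve the form whose matrix has ones on the antidiagonal and zeros elsewhere, and let $F_{ij}=E_{ij}-E_{-j,-i}\in\mathfrak o_{2n+1}$. For a list $I=(i_1,\dots,i_{2n})$ of indices let $$\mathrm{Pf}\,F_I=\frac1{2^n\,n!}\sum_{\pi\in S_{2n}}\mathrm{sgn}(\pi)\,F_{-i_{\pi(1)},i_{\pi(2)}}\cdots F_{-i_{\pi(2n-1)},i_{\pi(2n)}}\in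 U(\mathfrak o_{2n+1}).$$ Let $\rho$ denote also the representation of $U(\mathfrak o_{2n+1})$ on $W$, and define $$\tau^{\mathrm{Pf}}_{ij}=\sum_I\rho(\mathrm{Pf}F_I)^{(i)}\rho(\mathrm{Pf}F_{-I})^{(j)},\quad \mu^{\mathrm{Pf}}_{ij}=\sum_I\rho(\mathrm{Pf}F_I)^{(i)}\rho(\mathrm{Pf}F_I)^{(j)},$$ $$\nu^{\mathrm{Pf}}_i=\tfrac12\sum_I\rho(\mathrm{Pf}F_I\,\mathrm{Pf}F_{-I}+\mathrm{Pf}F_I\,\mathrm{Pf}F_I)^{(i)},$$ where $I$ runs over the $2n$-element subsets of $\{-n,\dots,n\}$, each listed in increasing order. **Theorem.** For every basis $(I_s)$ of $\mathcal T$, every $m$ and all $i\neq j$ in $\{1,\dots,m\}$, the operators on $W^{\otimes m}$ satisfy $$\tau^{\mathrm{Pf}}_{ij}=(n!)^2\,\tau_{ij},\qquad \mu^{\mathrm{Pf}}_{ij}=(n!)^2\,\mu_{ij},\qquad \nu^{\mathrm{Pf}}_i=(n!)^2\,\nu_i .$$ Thus the two sets of operators coincide when each $\mathrm{Pf}F_I$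 is normalized to $\tfrac1{\sqrt C}\mathrm{Pf}F_I$ with $C=(n!)^2$. -/

import Mathlib

noncomputable section

namespace KZPfaffian

open scoped TensorProduct

/-! ### Indices, skew-symmetric tensors -/

/-- The index set `{-n, …, n}`. -/
abbrev Idx (n : ℕ) := {i : ℤ // i ∈ Finset.Icc (-(n : ℤ)) n}

instance (n : ℕ) : InvolutiveNeg (Idx n) where
  neg i := ⟨-i.1, by have := Finset.mem_Icc.1 i.2; exact Finset.mem_Icc.2 ⟨by omega, by omega⟩⟩
  neg_neg i := Subtype.ext (neg_neg i.1)

/-- Tensors with `k` indices in `{-n, …, n}`, i.e. the components of elements of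
`(ℂ^{2n+1})^{⊗ k}` in the standard basis `e_{-n}, …, e_n`. -/
abbrev Tensor (n k : ℕ) := (Fin k → Idx n) → ℂ

/-- The space `Λ^k(ℂ^{2n+1})` of skew-symmetric tensors with `k` indices. -/
def Skew (n k : ℕ) : Submodule ℂ (Tensor n k) where
  carrier := {t | ∀ (π : Equiv.Perm (Fin k)) (a : Fin k → Idx n),
    t (a ∘ π) = ((Equiv.Perm.sign π : ℤ) : ℂ) * t a}
  zero_mem' := by intro π a; simp
  add_mem' := by
    intro s t hs ht π a
    simp only [Pi.add_apply, hs π a, ht π a, mul_add]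
  smul_mem' := by
    intro c t ht π a
    simp only [Pi.smul_apply, smul_eq_mul, ht π a]
    ring

lemma mem_Skew {n k : ℕ} {t : Tensor n k} : t ∈ Skew n k ↔
    ∀ (π : Equiv.Perm (Fin k)) (a : Fin k → Idx n),
      t (a ∘ π) = ((Equiv.Perm.sign π : ℤ) : ℂ) * t a := Iff.rfl

/-- The decomposable tensor `e_{c₁} ∧ … ∧ e_{c_k}`, with components `det (δ_{c_p, a_q})`. -/
def wedge {n k : ℕ} (c : Fin k → Idx n) : Skew n k :=
  ⟨fun a => (Matrix.of fun p q => if c p = a q then (1 : ℂ) else 0).det, by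
    intro π a
    exact Matrix.det_permute' π (Matrix.of fun p q => if c p = a q then (1 : ℂ) else 0)⟩

/-! ### The space `𝒯` of skew-symmetric tensors with `2n` indices -/

/-- The space `𝒯` of skew-symmetric tensors with `2n` indices. -/
abbrev T (n : ℕ) := Skew n (2 * n)

/-- The involution `e_{c₁} ∧ … ∧ e_{c_{2n}} ↦ e_{-c₁} ∧ … ∧ e_{-c_{2n}}` of `𝒯`. -/
def invol (n : ℕ) : T n →ₗ[ℂ] T n where
  toFun t := ⟨fun c => t.1 (-c), fun π a => t.2 π (-a)⟩
  map_add' _ _ := rfl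
  map_smul' _ _ := rfl

/-- The index list `a₁, …, a_n, b₁, …, b_n`. -/
def join {n : ℕ} (a b : Fin n → Idx n) : Fin (2 * n) → Idx n :=
  Fin.append a b ∘ Fin.cast (two_mul n)

lemma join_comp_left {n : ℕ} (π : Equiv.Perm (Fin n)) :
    ∃ π' : Equiv.Perm (Fin (2 * n)), Equiv.Perm.sign π' = Equiv.Perm.sign π ∧
      ∀ a b : Fin n → Idx n, join (a ∘ π) b = join a b ∘ π' := by
  let f : Fin n ⊕ Fin n ≃ Fin (2 * n) := finSumFinEquiv.trans (finCongr (two_mul n).symm)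
  refine ⟨f.permCongr (Equiv.sumCongr π (Equiv.refl _)), ?_, ?_⟩
  · rw [Equiv.Perm.sign_permCongr]
    simp
  · intro a b
    funext x
    obtain ⟨y, rfl⟩ := f.surjective x
    have h : f.permCongr (Equiv.sumCongr π (Equiv.refl _)) (f y) = f (Sum.map π id y) := by
      simp [Equiv.permCongr_apply]
    rw [Function.comp_apply, h]
    rcases y with y | y <;> simp [join, f, Fin.append, Fin.addCases]

/-- The action of `𝒯` on the skew-symmetric tensors with `n` indices, in components
`(ρ(t) s)_{a} = (1/n!) ∑_b t_{a, b} s_{-b}`. On decomposable tensors it is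
`e_{a₁}∧…∧e_{a_n}∧e_{b₁}∧…∧e_{b_n} : e_{-b₁}∧…∧e_{-b_n} ↦ e_{a₁}∧…∧e_{a_n}`
for distinct `a₁, …, a_n, b₁, …, b_n`, and `e_I` sends a basis vector
`e_R` with `-R ⊄ I` to `0`. -/
def repT (n : ℕ) : T n →ₗ[ℂ] Module.End ℂ (Skew n n) where
  toFun t :=
    { toFun := fun s => ⟨fun a => (n.factorial : ℂ)⁻¹ * ∑ b, t.1 (join a b) * s.1 (-b), by
        intro π a
        obtain ⟨π', hs, hπ⟩ := join_comp_left π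
        simp only [hπ, t.2 π' _, hs, Finset.mul_sum]
        exact Finset.sum_congr rfl fun b _ => by ring⟩
      map_add' := by
        intro s s'
        apply Subtype.ext; funext a
        simp [mul_add, Finset.sum_add_distrib]
      map_smul' := by
        intro c s
        apply Subtype.ext; funext a
        simp only [Submodule.coe_smul, Pi.smul_apply, smul_eq_mul, RingHom.id_apply,
          Finset.mul_sum]
        exact Finset.sum_congr rfl fun b _ => by ring }
  map_add' t t' := by
    ext s a
    simp [add_mul, mul_add, Finset.sum_add_distrib]
  map_smul' c t := by
    ext s a
    simp only [Submodule.coe_smul, Pi.smul_apply, smul_eq_mul, RingHom.id_apply,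
      LinearMap.coe_mk, AddHom.coe_mk, LinearMap.smul_apply, Finset.mul_sum]
    exact Finset.sum_congr rfl fun b _ => by ring

/-- The symmetric bilinear form on `𝒯` with `⟨e_I, e_{-I}⟩ = 1` and `⟨e_I, e_{-J}⟩ = 0` for
`I ≠ J`; here `e_I = e_{i₁} ∧ … ∧ e_{i_{2n}}` and `e_{-I} = e_{-i₁} ∧ … ∧ e_{-i_{2n}}`. So the
dual basis of `(e_I)` is `(e_{-I})`. -/
def form (n : ℕ) (t u : T n) : ℂ :=
  ((2 * n).factorial : ℂ)⁻¹ * ∑ c, t.1 c * u.1 (-c)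

/-! ### The values on decomposable tensors -/

lemma join_comp_right {n : ℕ} (π : Equiv.Perm (Fin n)) :
    ∃ π' : Equiv.Perm (Fin (2 * n)), Equiv.Perm.sign π' = Equiv.Perm.sign π ∧
      ∀ a b : Fin n → Idx n, join a (b ∘ π) = join a b ∘ π' := by
  let f : Fin n ⊕ Fin n ≃ Fin (2 * n) := finSumFinEquiv.trans (finCongr (two_mul n).symm)
  refine ⟨f.permCongr (Equiv.sumCongr (Equiv.refl _) π), ?_, ?_⟩
  · rw [Equiv.Perm.sign_permCongr]
    simp
  · intro a b
    funext x
    obtain ⟨y, rfl⟩ := f.surjective x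
    have h : f.permCongr (Equiv.sumCongr (Equiv.refl _) π) (f y) = f (Sum.map id π y) := by
      simp [Equiv.permCongr_apply]
    rw [Function.comp_apply, h]
    rcases y with y | y <;> simp [join, f, Fin.append, Fin.addCases]

lemma wedge_apply {n k : ℕ} (c a : Fin k → Idx n) :
    (wedge c).1 a = (Matrix.of fun p q => if c p = a q then (1 : ℂ) else 0).det := rfl

lemma wedge_apply_self {n k : ℕ} {c : Fin k → Idx n} (hc : Function.Injective c) :
    (wedge c).1 c = 1 := by
  rw [wedge_apply]
  convert Matrix.det_one (R := ℂ) (n := Fin k)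
  ext p q
  simp [Matrix.one_apply, hc.eq_iff]

lemma wedge_apply_eq_zero {n k : ℕ} {c a : Fin k → Idx n}
    (h : ¬ ∃ π : Equiv.Perm (Fin k), a = c ∘ π) : (wedge c).1 a = 0 := by
  rw [wedge_apply]
  by_cases ha : ∀ q, ∃ p, c p = a q
  · choose g hg using ha
    have hg' : ¬ Function.Injective g := fun hi =>
      h ⟨Equiv.ofBijective g (Finite.injective_iff_bijective.1 hi), funext fun q => (hg q).symm⟩
    obtain ⟨q, q', e, hne⟩ : ∃ q q', g q = g q' ∧ q ≠ q' := by
      simpa [Function.Injective] using hg'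
    refine Matrix.det_zero_of_column_eq hne fun p => ?_
    simp [← hg q, ← hg q', e]
  · push Not at ha
    obtain ⟨q, hq⟩ := ha
    exact Matrix.det_eq_zero_of_column_eq_zero q fun p => by simp [hq p]

/-- `e_{a₁}∧…∧e_{a_n}∧e_{b₁}∧…∧e_{b_n}` sends `e_{-b₁}∧…∧e_{-b_n}` to `e_{a₁}∧…∧e_{a_n}`. -/
lemma repT_wedge {n : ℕ} (a b : Fin n → Idx n) (h : Function.Injective (join a b)) :
    repT n (wedge (join a b)) (wedge (-b)) = wedge a := by
  let f : Fin n ⊕ Fin n ≃ Fin (2 * n) := finSumFinEquiv.trans (finCongr (two_mul n).symm)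
  have hl : ∀ (x y : Fin n → Idx n) p, join x y (f (Sum.inl p)) = x p := fun x y p => by
    simp [join, f]
  have hr : ∀ (x y : Fin n → Idx n) p, join x y (f (Sum.inr p)) = y p := fun x y p => by
    simp [join, f, Fin.append, Fin.addCases]
  have hb : Function.Injective b := fun p q e => by
    have := h ((hr a b p).trans (e.trans (hr a b q).symm))
    simpa using this
  have hab : ∀ p q, a p ≠ b q := fun p q e => by
    have := h ((hl a b p).trans (e.trans (hr a b q).symm))
    simp at this
  have hneg : ∀ y : Fin n → Idx n, (wedge (-b)).1 (-y) = (wedge b).1 y := fun y => by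
    simp [wedge_apply]
  apply Subtype.ext; funext x
  change (n.factorial : ℂ)⁻¹ * ∑ y, (wedge (join a b)).1 (join x y) * (wedge (-b)).1 (-y) = _
  have h1 : ∑ y, (wedge (join a b)).1 (join x y) * (wedge (-b)).1 (-y)
      = ∑ _π : Equiv.Perm (Fin n), (wedge (join a b)).1 (join x b) := by
    symm
    refine Finset.sum_of_injOn (fun π : Equiv.Perm (Fin n) => b ∘ π) ?_ (by simp) ?_ ?_
    · intro π _ π' _ e
      exact Equiv.ext fun p => hb (congrFun e p)
    · intro y _ hy
      rw [hneg, wedge_apply_eq_zero (c := b), mul_zero]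
      rintro ⟨π, rfl⟩
      exact hy ⟨π, by simp, rfl⟩
    · intro π _
      obtain ⟨π', hs, hπ⟩ := join_comp_right (n := n) π
      rw [hneg, (wedge b).2 π b, wedge_apply_self hb, hπ, (wedge (join a b)).2 π', hs]
      rcases Int.units_eq_one_or (Equiv.Perm.sign π) with e | e <;> simp [e]
  have h2 : (wedge (join a b)).1 (join x b) = (wedge a).1 x := by
    rw [wedge_apply, ← Matrix.det_submatrix_equiv_self f]
    have : (Matrix.of fun p q => if join a b p = join x b q then (1 : ℂ) else 0).submatrix f f
        = Matrix.fromBlocks (Matrix.of fun p q => if a p = x q then (1 : ℂ) else 0) 0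
          (Matrix.of fun p q => if b p = x q then (1 : ℂ) else 0) 1 := by
      ext p q
      rcases p with p | p <;> rcases q with q | q <;>
        simp [hl, hr, hab, Matrix.one_apply, hb.eq_iff]
    rw [this, Matrix.det_fromBlocks_zero₁₂, Matrix.det_one, mul_one, wedge_apply]
  rw [h1, h2, Finset.sum_const, Finset.card_univ, Fintype.card_perm, Fintype.card_fin,
    nsmul_eq_mul, inv_mul_cancel_left₀ (Nat.cast_ne_zero.2 n.factorial_ne_zero)]

/-- `e_I` sends `e_R` to `0` if `-R ⊄ I`. -/
lemma repT_wedge_eq_zero {n : ℕ} (c : Fin (2 * n) → Idx n) (r : Fin n → Idx n)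
    (h : ∃ q, ∀ p, c p ≠ -r q) : repT n (wedge c) (wedge r) = 0 := by
  obtain ⟨q, hq⟩ := h
  apply Subtype.ext; funext x
  change (n.factorial : ℂ)⁻¹ * ∑ y, (wedge c).1 (join x y) * (wedge r).1 (-y) = 0
  rw [Finset.sum_eq_zero, mul_zero]
  intro y _
  by_cases hy : ∃ π : Equiv.Perm (Fin n), -y = r ∘ π
  · obtain ⟨π, hπ⟩ := hy
    rw [wedge_apply_eq_zero, zero_mul]
    rintro ⟨π', h'⟩
    have h3 : y (π.symm q) = -r q := by
      have := congrFun hπ (π.symm q)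
      simp only [Pi.neg_apply, Function.comp_apply, Equiv.apply_symm_apply] at this
      rw [← this, neg_neg]
    have h4 := congrFun h' (Fin.cast (two_mul n).symm (Fin.natAdd n (π.symm q)))
    rw [Function.comp_apply] at h4
    refine hq _ (h4.symm.trans (Eq.trans ?_ h3))
    simp [join, Fin.append, Fin.addCases]
  · rw [wedge_apply_eq_zero hy, mul_zero]

/-- `⟨e_I, e_{-I}⟩ = 1`. -/
lemma form_wedge {n : ℕ} {c : Fin (2 * n) → Idx n} (h : Function.Injective c) :
    form n (wedge c) (wedge (-c)) = 1 := by
  have hneg : ∀ y : Fin (2 * n) → Idx n, (wedge (-c)).1 (-y) = (wedge c).1 y := fun y => by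
    simp [wedge_apply]
  have h1 : ∑ y, (wedge c).1 y * (wedge (-c)).1 (-y)
      = ∑ _π : Equiv.Perm (Fin (2 * n)), (1 : ℂ) := by
    symm
    refine Finset.sum_of_injOn (fun π : Equiv.Perm (Fin (2 * n)) => c ∘ π) ?_ (by simp) ?_ ?_
    · intro π _ π' _ e
      exact Equiv.ext fun p => h (congrFun e p)
    · intro y _ hy
      rw [hneg, wedge_apply_eq_zero, mul_zero]
      rintro ⟨π, rfl⟩
      exact hy ⟨π, by simp, rfl⟩
    · intro π _
      rw [hneg, (wedge c).2 π c, wedge_apply_self h]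
      rcases Int.units_eq_one_or (Equiv.Perm.sign π) with e | e <;> simp [e]
  rw [form, h1, Finset.sum_const, Finset.card_univ, Fintype.card_perm, Fintype.card_fin,
    nsmul_eq_mul, mul_one, inv_mul_cancel₀ (Nat.cast_ne_zero.2 (Nat.factorial_ne_zero _))]

/-- `⟨e_I, e_{-J}⟩ = 0` for `I ≠ J`. -/
lemma form_wedge_eq_zero {n : ℕ} {c d : Fin (2 * n) → Idx n}
    (h : Set.range c ≠ Set.range d) : form n (wedge c) (wedge (-d)) = 0 := by
  have hneg : ∀ y : Fin (2 * n) → Idx n, (wedge (-d)).1 (-y) = (wedge d).1 y := fun y => by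
    simp [wedge_apply]
  rw [form, Finset.sum_eq_zero, mul_zero]
  intro y _
  rw [hneg]
  by_cases h1 : ∃ π : Equiv.Perm (Fin (2 * n)), y = c ∘ π
  · by_cases h2 : ∃ π : Equiv.Perm (Fin (2 * n)), y = d ∘ π
    · obtain ⟨π, rfl⟩ := h1
      obtain ⟨π', h2⟩ := h2
      have := congrArg Set.range h2
      simp only [EquivLike.range_comp] at this
      exact absurd this h
    · rw [wedge_apply_eq_zero h2, mul_zero]
  · rw [wedge_apply_eq_zero h1, zero_mul]

/-- `σ(e_I) = e_{-I}`. -/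
lemma invol_wedge {n : ℕ} (c : Fin (2 * n) → Idx n) : invol n (wedge c) = wedge (-c) := by
  apply Subtype.ext; funext y
  change (wedge c).1 (-y) = (wedge (-c)).1 y
  simp [wedge_apply, neg_eq_iff_eq_neg]

/-! ### Operators on tensor powers -/

/-- `1 ⊗ … ⊗ A ⊗ … ⊗ 1`, with `A` on the place `i`. -/
def onPlace {W : Type*} [AddCommGroup W] [Module ℂ W] {m : ℕ} (i : Fin m) (A : Module.End ℂ W) :
    Module.End ℂ (⨂[ℂ] _ : Fin m, W) :=
  PiTensorProduct.map (Function.update (fun _ => LinearMap.id) i A)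

/-- `1 ⊗ … ⊗ A ⊗ … ⊗ B ⊗ … ⊗ 1`, with `A` on the place `i` and `B` on the place `j` (`i ≠ j`). -/
def onPlaces {W : Type*} [AddCommGroup W] [Module ℂ W] {m : ℕ} (i j : Fin m)
    (A B : Module.End ℂ W) : Module.End ℂ (⨂[ℂ] _ : Fin m, W) :=
  PiTensorProduct.map (Function.update (Function.update (fun _ => LinearMap.id) i A) j B)

/-! ### The coefficients defined by `𝒯`: `I_s` is a basis of `𝒯` and `d_s` the dual basis -/

variable {n m : ℕ} {ι : Type*} [Fintype ι]

/-- `τ_ij = ∑_s 1 ⊗ … ⊗ ρ(I_s) ⊗ … ⊗ ρ(d_s) ⊗ … ⊗ 1`. -/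
def tau (I d : ι → T n) (i j : Fin m) : Module.End ℂ (⨂[ℂ] _ : Fin m, Skew n n) :=
  ∑ s, onPlaces i j (repT n (I s)) (repT n (d s))

/-- `μ_ij = ∑_s 1 ⊗ … ⊗ ρ(I_s) ⊗ … ⊗ ρ(σ(d_s)) ⊗ … ⊗ 1`. -/
def mu (I d : ι → T n) (i j : Fin m) : Module.End ℂ (⨂[ℂ] _ : Fin m, Skew n n) :=
  ∑ s, onPlaces i j (repT n (I s)) (repT n (invol n (d s)))

/-- `ν_i = 1/2 ∑_s 1 ⊗ … ⊗ (ρ(I_s) ρ(σ(d_s)) + ρ(I_s) ρ(d_s)) ⊗ … ⊗ 1`.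
(For an orthonormal basis, `I_s = d_s` and the last term is `ρ(I_s)²`.) -/
def nu (I d : ι → T n) (i : Fin m) : Module.End ℂ (⨂[ℂ] _ : Fin m, Skew n n) :=
  (1 / 2 : ℂ) • ∑ s, onPlace i
    (repT n (I s) * repT n (invol n (d s)) + repT n (I s) * repT n (d s))

/-! ### The orthogonal Lie algebra in the split realization -/

attribute [local instance] LieRing.ofAssociativeRing

/-- The matrix `G` of the quadratic form, with ones on the antidiagonal. -/
def gram (n : ℕ) : Matrix (Idx n) (Idx n) ℂ := Matrix.of fun i j => if i = -j then 1 else 0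

/-- `𝔬_{2n+1}`: the matrices `A` with `Aᵀ G + G A = 0`. -/
abbrev so (n : ℕ) : LieSubalgebra ℂ (Matrix (Idx n) (Idx n) ℂ) :=
  skewAdjointMatricesLieSubalgebra (gram n)

/-- `F_ij = E_ij - E_{-j,-i}`. -/
def F {n : ℕ} (i j : Idx n) : so n :=
  ⟨Matrix.single i j 1 - Matrix.single (-j) (-i) 1, by
    rw [mem_skewAdjointMatricesLieSubalgebra, mem_skewAdjointMatricesSubmodule,
      Matrix.IsSkewAdjoint, Matrix.IsAdjointPair]
    ext a b
    have h : ∀ c d : Idx n, (c = -d) = (d = -c) := fun c d => propext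
      ⟨fun h => by rw [h, neg_neg], fun h => by rw [h, neg_neg]⟩
    simp only [gram, Matrix.mul_apply, Matrix.transpose_apply, Matrix.sub_apply, Matrix.neg_apply,
      Matrix.single_apply, Matrix.of_apply]
    simp only [h a, mul_ite, ite_mul, mul_one, one_mul, mul_zero, zero_mul, Finset.sum_ite_eq',
      Finset.mem_univ, if_true, neg_sub]
    congr 1 <;> refine if_congr ?_ rfl rfl <;> rw [and_comm] <;>
      simp only [neg_eq_iff_eq_neg, neg_neg, h]⟩

/-- The action of a matrix `X` on the `p`-th index of a tensor. -/
def actAt {n k : ℕ} (p : Fin k) (X : Matrix (Idx n) (Idx n) ℂ) : Module.End ℂ (Tensor n k) where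
  toFun t a := ∑ c, X (a p) c * t (Function.update a p c)
  map_add' s t := by
    funext a
    simp [mul_add, Finset.sum_add_distrib]
  map_smul' r t := by
    funext a
    simp only [Pi.smul_apply, smul_eq_mul, RingHom.id_apply, Finset.mul_sum]
    exact Finset.sum_congr rfl fun c _ => by ring

lemma actAt_apply {n k : ℕ} (p : Fin k) (X : Matrix (Idx n) (Idx n) ℂ) (t : Tensor n k)
    (a : Fin k → Idx n) : actAt p X t a = ∑ c, X (a p) c * t (Function.update a p c) := rfl

/-- The action of a matrix on the tensors with `k` indices: the sum over all places of the
action of the matrix on that index, so that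
`X (v₁ ⊗ … ⊗ v_k) = ∑_p v₁ ⊗ … ⊗ X v_p ⊗ … ⊗ v_k`. -/
def act {n k : ℕ} (X : Matrix (Idx n) (Idx n) ℂ) : Module.End ℂ (Tensor n k) :=
  ∑ p, actAt p X

lemma act_mem {n k : ℕ} (X : Matrix (Idx n) (Idx n) ℂ) (t : Tensor n k) (ht : t ∈ Skew n k) :
    act X t ∈ Skew n k := by
  intro π a
  simp only [act, LinearMap.sum_apply, Finset.sum_apply, actAt_apply, Finset.mul_sum]
  rw [← Equiv.sum_comp π (fun p => ∑ c, ((Equiv.Perm.sign π : ℤ) : ℂ) *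
    (X (a p) c * t (Function.update a p c)))]
  refine Finset.sum_congr rfl fun p _ => Finset.sum_congr rfl fun c _ => ?_
  rw [← Function.update_comp_eq_of_injective a π.injective, ht π, Function.comp_apply]
  ring

lemma actAt_add {n k : ℕ} (p : Fin k) (X Y : Matrix (Idx n) (Idx n) ℂ) :
    actAt p (X + Y) = actAt p X + actAt p Y := by
  refine LinearMap.ext fun t => funext fun a => ?_
  simp [actAt_apply, add_mul, Finset.sum_add_distrib]

lemma actAt_smul {n k : ℕ} (p : Fin k) (r : ℂ) (X : Matrix (Idx n) (Idx n) ℂ) :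
    actAt p (r • X) = r • actAt p X := by
  refine LinearMap.ext fun t => funext fun a => ?_
  simp [actAt_apply, Finset.mul_sum, mul_assoc]

lemma actAt_mul {n k : ℕ} (p : Fin k) (X Y : Matrix (Idx n) (Idx n) ℂ) :
    actAt p X * actAt p Y = actAt p (X * Y) := by
  refine LinearMap.ext fun t => funext fun a => ?_
  simp only [Module.End.mul_apply, actAt_apply, Function.update_self, Function.update_idem,
    Matrix.mul_apply, Finset.mul_sum, Finset.sum_mul]
  rw [Finset.sum_comm]
  exact Finset.sum_congr rfl fun c _ => Finset.sum_congr rfl fun d _ => by ring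

lemma actAt_comm {n k : ℕ} {p q : Fin k} (h : p ≠ q) (X Y : Matrix (Idx n) (Idx n) ℂ) :
    actAt p X * actAt q Y = actAt q Y * actAt p X := by
  refine LinearMap.ext fun t => funext fun a => ?_
  simp only [Module.End.mul_apply, actAt_apply, Function.update_of_ne h, Function.update_of_ne h.symm,
    Finset.mul_sum]
  rw [Finset.sum_comm]
  refine Finset.sum_congr rfl fun c _ => Finset.sum_congr rfl fun d _ => ?_
  rw [Function.update_comm h]
  ring

lemma act_lie {n k : ℕ} (X Y : Matrix (Idx n) (Idx n) ℂ) :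
    (act (X * Y - Y * X) : Module.End ℂ (Tensor n k)) = act X * act Y - act Y * act X := by
  have hs : ∀ p : Fin k, actAt p (X * Y - Y * X) = actAt p (X * Y) - actAt p (Y * X) := fun p =>
    eq_sub_of_add_eq (by rw [← actAt_add, sub_add_cancel])
  simp only [act, Finset.sum_mul_sum, hs]
  rw [Finset.sum_comm (f := fun p q => actAt p Y * actAt q X), ← Finset.sum_sub_distrib]
  refine Finset.sum_congr rfl fun p _ => ?_
  rw [← Finset.sum_sub_distrib, Finset.sum_eq_single p, actAt_mul, actAt_mul]
  · intro q _ hq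
    rw [actAt_comm hq.symm, sub_self]
  · simp

/-- The representation of `𝔬_{2n+1}` on the skew-symmetric tensors with `k` indices. -/
def repSkew (n k : ℕ) : so n →ₗ⁅ℂ⁆ Module.End ℂ (Skew n k) where
  toFun X := (act X.1).restrict (act_mem X.1)
  map_add' X Y := by
    refine LinearMap.ext fun t => Subtype.ext ?_
    simp [act, actAt_add, Finset.sum_add_distrib]
  map_smul' r X := by
    refine LinearMap.ext fun t => Subtype.ext ?_
    simp [act, actAt_smul, Finset.smul_sum]
  map_lie' := by
    intro X Y
    refine LinearMap.ext fun t => Subtype.ext ?_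
    exact congrArg (fun f : Module.End ℂ (Tensor n k) => f t.1) (act_lie X.1 Y.1)

/-- Its extension to the universal enveloping algebra `U(𝔬_{2n+1})`. -/
def repU (n k : ℕ) : UniversalEnvelopingAlgebra ℂ (so n) →ₐ[ℂ] Module.End ℂ (Skew n k) :=
  UniversalEnvelopingAlgebra.lift ℂ (repSkew n k)

/-! ### Noncommutative Pfaffians -/

/-- The noncommutative Pfaffian of a `2r × 2r` matrix,
`Pf Φ = 1/(2^r r!) ∑_σ sgn(σ) Φ_{σ(1)σ(2)} ⋯ Φ_{σ(2r-1)σ(2r)}`. -/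
def pf {A : Type*} [Ring A] [Algebra ℂ A] {r : ℕ} (Φ : Matrix (Fin (2 * r)) (Fin (2 * r)) A) : A :=
  ((2 : ℂ) ^ r * (r.factorial : ℂ))⁻¹ • ∑ σ : Equiv.Perm (Fin (2 * r)),
    ((Equiv.Perm.sign σ : ℤ) : ℂ) • (List.ofFn fun p : Fin r =>
      Φ (σ ⟨2 * p, by omega⟩) (σ ⟨2 * p + 1, by omega⟩)).prod

/-- `Pf F_I = Pf (F_{-i,j})_{i,j ∈ I} ∈ U(𝔬_{2n+1})` for a list `I = (i₁, …, i_{2r})`. -/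
def pfF {n r : ℕ} (I : Fin (2 * r) → Idx n) : UniversalEnvelopingAlgebra ℂ (so n) :=
  pf (Matrix.of fun p q => UniversalEnvelopingAlgebra.ι ℂ (F (-(I p)) (I q)))

/-- `ρ(Pf F_I)` on the skew-symmetric tensors with `n` indices. -/
def rhoPf {n : ℕ} (I : Fin (2 * n) → Idx n) : Module.End ℂ (Skew n n) := repU n n (pfF I)

/-- The `2n`-element subsets `I ⊆ {-n, …, n}`, each listed in increasing order. If
`I = (i₁, …, i_{2n})` is such a list, then `-I` is the list `(-i₁, …, -i_{2n})`. -/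
abbrev Subsets (n : ℕ) := Fin (2 * n) ↪o Idx n

/-- `τ_ij = ∑_I 1 ⊗ … ⊗ ρ(Pf F_I) ⊗ … ⊗ ρ(Pf F_{-I}) ⊗ … ⊗ 1`. -/
def tauPf (n : ℕ) (i j : Fin m) : Module.End ℂ (⨂[ℂ] _ : Fin m, Skew n n) :=
  ∑ I : Subsets n, onPlaces i j (rhoPf I) (rhoPf (-⇑I))

/-- `μ_ij = ∑_I 1 ⊗ … ⊗ ρ(Pf F_I) ⊗ … ⊗ ρ(Pf F_I) ⊗ … ⊗ 1`. -/
def muPf (n : ℕ) (i j : Fin m) : Module.End ℂ (⨂[ℂ] _ : Fin m, Skew n n) :=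
  ∑ I : Subsets n, onPlaces i j (rhoPf I) (rhoPf I)

/-- `ν_i = 1/2 ∑_I 1 ⊗ … ⊗ ρ(Pf F_I Pf F_{-I} + Pf F_I Pf F_I) ⊗ … ⊗ 1`. -/
def nuPf (n : ℕ) (i : Fin m) : Module.End ℂ (⨂[ℂ] _ : Fin m, Skew n n) :=
  (1 / 2 : ℂ) • ∑ I : Subsets n, onPlace i
    (repU n n (pfF I * pfF (-⇑I) + pfF I * pfF I))

end KZPfaffian

end

/-!
The Pfaffian `Pf F_I` acts on the skew-symmetric tensors with `n` indices as `± n! e_{-I}`, with a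
sign that depends only on `n` (`rhoPf_eq_smul_repT`). Each of the operators in question is quadratic
in the Pfaffians, so the sign disappears and `n!` becomes `(n!)²`.

For this fact, write `F_{-i,j} = E_{-i,j} - E_{-j,i}`. Under the signed sum over permutations that
defines the Pfaffian, each factor `F_{-i,j}` may be replaced by `2 E_{-i,j}`
(`sum_sign_smul_prod_antisymm`). A matrix acts on a tensor as the sum of its actions on the `n`
indices, so the product of the `n` factors expands into a sum over all assignments `f` of factors to
indices. If `f` is not injective, take two successive factors `E_{-i,j}`, `E_{-k,l}` acting on the
same index; their product `δ_{j,-k} E_{-i,l}` is symmetric in `j` and `k`, and the signed sum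
vanishes (`sum_sign_smul_prod_actAt_eq_zero`). If `f` is bijective, the factors commute, and as a
simultaneous permutation of the pairs is even, all `n!` such `f` give the same contribution
(`sum_sign_smul_prod_actAt_apply`). Up to the sign of the unshuffle of `n` pairs into two blocks,
this contribution is the expansion of the determinant in the components of `e_{-I}`, acting
by `repT` (`repT_wedge_neg_apply`).

It remains to pass from the pair of dual bases `(e_{-S})`, `(e_S)` to an arbitrary one. The
operators are values of bilinear maps on `∑_s I_s ⊗ I_s^*`, which is the same for all pairs of dual
bases (`sum_wedge_eq_sum_basis`).
-/

noncomputable section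

namespace KZPfaffian

open Equiv
open scoped TensorProduct

/-! ### Signed sums over permutations -/

lemma sum_sign_smul_mul_right {α A : Type*} [Fintype α] [DecidableEq α] [AddCommGroup A]
    [Module ℂ A] (P : Perm α → A) (κ : Perm α) :
    ∑ π, ((Perm.sign π : ℤ) : ℂ) • P π =
      ((Perm.sign κ : ℤ) : ℂ) • ∑ π, ((Perm.sign π : ℤ) : ℂ) • P (π * κ) := by
  rw [← Equiv.sum_comp (Equiv.mulRight κ), Finset.smul_sum]
  refine Finset.sum_congr rfl fun π _ => ?_
  rw [Equiv.coe_mulRight, Perm.sign_mul, smul_smul]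
  push_cast
  rw [mul_comm]

lemma perm_sign_mul_self {α : Type*} [Fintype α] [DecidableEq α] (κ : Perm α) :
    ((Perm.sign κ : ℤ) : ℂ) * ((Perm.sign κ : ℤ) : ℂ) = 1 := by
  rcases Int.units_eq_one_or (Perm.sign κ) with e | e <;> simp [e]

/-- Positions in a list of `2n` indices, arranged in `n` consecutive pairs: `(p, ε)` is the
position `2p + ε`. -/
def pairPos (n : ℕ) : Fin n × Fin 2 ≃ Fin (2 * n) :=
  finProdFinEquiv.trans (finCongr (mul_comm n 2))

/-- Positions in a list of `2n` indices, arranged in two consecutive blocks of length `n`. -/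
def blockPos (n : ℕ) : Fin n ⊕ Fin n ≃ Fin (2 * n) :=
  finSumFinEquiv.trans (finCongr (two_mul n).symm)

/-- The unshuffle that carries the blocks of `blockPos` to the first and the second members of
the pairs of `pairPos`. -/
def unshuffle (n : ℕ) : Perm (Fin (2 * n)) :=
  (blockPos n).symm.trans
    ((Equiv.boolProdEquivSum (Fin n)).symm.trans
      ((Equiv.prodCongr finTwoEquiv.symm (Equiv.refl _)).trans
        ((Equiv.prodComm _ _).trans (pairPos n))))

lemma unshuffle_inl {n : ℕ} (p : Fin n) :
    unshuffle n (blockPos n (Sum.inl p)) = pairPos n (p, 0) := by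
  simp [unshuffle]; rfl

lemma unshuffle_inr {n : ℕ} (p : Fin n) :
    unshuffle n (blockPos n (Sum.inr p)) = pairPos n (p, 1) := by
  simp [unshuffle]; rfl

lemma pairPos_zero {n : ℕ} (p : Fin n) : pairPos n (p, 0) = ⟨2 * p, by omega⟩ := by
  ext; simp [pairPos]

lemma pairPos_one {n : ℕ} (p : Fin n) : pairPos n (p, 1) = ⟨2 * p + 1, by omega⟩ := by
  ext; simp [pairPos]; omega

lemma join_blockPos_inl {n : ℕ} (a b : Fin n → Idx n) (p : Fin n) :
    join a b (blockPos n (Sum.inl p)) = a p := by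
  simp [join, blockPos]

lemma join_blockPos_inr {n : ℕ} (a b : Fin n → Idx n) (p : Fin n) :
    join a b (blockPos n (Sum.inr p)) = b p := by
  simp [join, blockPos, Fin.append, Fin.addCases]

/-! ### Noncommutative products of sums -/

lemma prod_ofFn_sum {A κ : Type*} [Ring A] [Algebra ℂ A] [Fintype κ] {n : ℕ}
    (G : Fin n → κ → A) :
    (List.ofFn fun k => ∑ x, G k x).prod =
      ∑ f : Fin n → κ, (List.ofFn fun k => G k (f k)).prod := by
  simpa only [MultilinearMap.mkPiAlgebraFin_apply] using
    (MultilinearMap.mkPiAlgebraFin ℂ n A).map_sum (α := fun _ => κ) G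

lemma prod_ofFn_smul {A : Type*} [Ring A] [Algebra ℂ A] {n : ℕ} (c : Fin n → ℂ)
    (G : Fin n → A) :
    (List.ofFn fun k => c k • G k).prod = (∏ k, c k) • (List.ofFn G).prod := by
  simpa only [MultilinearMap.mkPiAlgebraFin_apply] using
    (MultilinearMap.mkPiAlgebraFin ℂ n A).map_smul_univ c G

lemma sum_perm_fin_two {A : Type*} [AddCommGroup A] (f : Perm (Fin 2) → A) :
    ∑ τ, f τ = f 1 + f (swap 0 1) := by
  have h : (Finset.univ : Finset (Perm (Fin 2))) = {1, swap 0 1} := by decide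
  rw [h, Finset.sum_pair (by decide)]

/-- In a signed sum over permutations, antisymmetrizing the entries `G x y` multiplies the sum by
`2` for each factor. -/
lemma sum_sign_smul_prod_antisymm {A : Type*} [Ring A] [Algebra ℂ A] {n : ℕ}
    (G : Fin (2 * n) → Fin (2 * n) → A) :
    ∑ π : Perm (Fin (2 * n)), ((Perm.sign π : ℤ) : ℂ) • (List.ofFn fun k : Fin n =>
        (G (π (pairPos n (k, 0))) (π (pairPos n (k, 1))) -
          G (π (pairPos n (k, 1))) (π (pairPos n (k, 0))))).prod =
      (2 : ℂ) ^ n • ∑ π : Perm (Fin (2 * n)), ((Perm.sign π : ℤ) : ℂ) • (List.ofFn fun k : Fin n =>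
        G (π (pairPos n (k, 0))) (π (pairPos n (k, 1)))).prod := by
  have h1 : ∀ π : Perm (Fin (2 * n)), (List.ofFn fun k : Fin n =>
        (G (π (pairPos n (k, 0))) (π (pairPos n (k, 1))) -
          G (π (pairPos n (k, 1))) (π (pairPos n (k, 0))))).prod =
      ∑ τ : Fin n → Perm (Fin 2), (∏ k, ((Perm.sign (τ k) : ℤ) : ℂ)) •
        (List.ofFn fun k => G (π (pairPos n (k, τ k 0))) (π (pairPos n (k, τ k 1)))).prod := by
    intro π
    simp only [← prod_ofFn_smul]
    rw [← prod_ofFn_sum (fun k (τ : Perm (Fin 2)) => ((Perm.sign τ : ℤ) : ℂ) •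
      G (π (pairPos n (k, τ 0))) (π (pairPos n (k, τ 1))))]
    congr 2
    funext k
    rw [sum_perm_fin_two]
    simp [sub_eq_add_neg]
  simp only [h1, Finset.smul_sum (s := (Finset.univ : Finset (Fin n → Perm (Fin 2))))]
  rw [Finset.sum_comm]
  -- Reindexing by the permutation of the positions that acts as `τ k` on the `k`-th pair: its sign
  -- is the product of the signs of the `τ k`.
  have h2 : ∀ τ : Fin n → Perm (Fin 2),
      ∑ π : Perm (Fin (2 * n)), ((Perm.sign π : ℤ) : ℂ) • (∏ k, ((Perm.sign (τ k) : ℤ) : ℂ)) •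
        (List.ofFn fun k => G (π (pairPos n (k, τ k 0))) (π (pairPos n (k, τ k 1)))).prod =
      ∑ π : Perm (Fin (2 * n)), ((Perm.sign π : ℤ) : ℂ) • (List.ofFn fun k : Fin n =>
        G (π (pairPos n (k, 0))) (π (pairPos n (k, 1)))).prod := by
    intro τ
    conv_rhs => rw [sum_sign_smul_mul_right _ ((pairPos n).permCongr (Equiv.prodCongrRight τ)),
      Perm.sign_permCongr, Perm.sign_prodCongrRight, Finset.smul_sum]
    refine Finset.sum_congr rfl fun π _ => ?_
    rw [smul_comm]
    simp [Equiv.permCongr_apply]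
  simp only [h2]
  simp [Fintype.card_perm, ← Nat.cast_smul_eq_nsmul ℂ]

/-! ### Products of one-place operators -/

/-- If no earlier factor acts on the place of the `l`-th one, an operator on that place can be
moved to the right and absorbed into the `l`-th factor. -/
lemma actAt_mul_prod_ofFn {n k : ℕ} : ∀ {r : ℕ} (f : Fin r → Fin k)
    (X : Fin r → Matrix (Idx n) (Idx n) ℂ) (l : Fin r) (_ : ∀ m < l, f m ≠ f l)
    (A : Matrix (Idx n) (Idx n) ℂ),
    actAt (f l) A * (List.ofFn fun m => actAt (f m) (X m)).prod =
      (List.ofFn fun m => actAt (f m) (Function.update X l (A * X l) m)).prod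
  | 0, _, _, l, _, _ => l.elim0
  | r + 1, f, X, l, h, A => by
    rw [List.ofFn_succ, List.ofFn_succ, List.prod_cons, List.prod_cons, ← mul_assoc]
    induction l using Fin.cases with
    | zero => simp [actAt_mul]
    | succ l =>
      have ih := actAt_mul_prod_ofFn (fun m => f m.succ) (fun m => X m.succ) l
        (fun m hm => h m.succ (Fin.succ_lt_succ_iff.2 hm)) A
      rw [actAt_comm (h 0 (Fin.succ_pos l)).symm, mul_assoc, ih,
        Function.update_of_ne (Fin.succ_ne_zero l).symm]
      congr 4
      funext m
      rcases eq_or_ne m l with rfl | hm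
      · simp
      · simp [hm]

/-- A product of one-place operators depends on two successive factors acting on the same place
only through their matrix product. -/
lemma prod_actAt_congr {n k : ℕ} : ∀ {r : ℕ} (f : Fin r → Fin k)
    (X Y : Fin r → Matrix (Idx n) (Idx n) ℂ) (p l : Fin r) (_ : p < l) (_ : f p = f l)
    (_ : ∀ m, p < m → m < l → f m ≠ f l) (_ : X p * X l = Y p * Y l)
    (_ : ∀ m, m ≠ p → m ≠ l → X m = Y m),
    (List.ofFn fun m => actAt (f m) (X m)).prod = (List.ofFn fun m => actAt (f m) (Y m)).prod
  | 0, _, _, _, p, _, _, _, _, _, _ => p.elim0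
  | r + 1, f, X, Y, p, l, hpl, hf, hm, hXY, he => by
    rw [List.ofFn_succ, List.ofFn_succ, List.prod_cons, List.prod_cons]
    induction l using Fin.cases with
    | zero => exact absurd hpl (Fin.not_lt_zero p)
    | succ l =>
      induction p using Fin.cases with
      | zero =>
        have hm' : ∀ m < l, f m.succ ≠ f l.succ := fun m h =>
          hm m.succ (Fin.succ_pos m) (Fin.succ_lt_succ_iff.2 h)
        rw [hf, actAt_mul_prod_ofFn (fun m => f m.succ) (fun m => X m.succ) l hm',
          actAt_mul_prod_ofFn (fun m => f m.succ) (fun m => Y m.succ) l hm', hXY]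
        congr 2
        funext m
        rcases eq_or_ne m l with rfl | h
        · simp
        · simp [h, he m.succ (Fin.succ_ne_zero m) (by simpa using h)]
      | succ p =>
        rw [he 0 (Fin.succ_ne_zero p).symm (Fin.succ_ne_zero l).symm,
          prod_actAt_congr (fun m => f m.succ) (fun m => X m.succ) (fun m => Y m.succ) p l
            (Fin.succ_lt_succ_iff.1 hpl) hf
            (fun m h h' => hm m.succ (Fin.succ_lt_succ_iff.2 h) (Fin.succ_lt_succ_iff.2 h'))
            hXY (fun m h h' => he m.succ (by simpa using h) (by simpa using h'))]

lemma actAt_single_apply {n k : ℕ} (p : Fin k) (u v : Idx n) (t : Tensor n k)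
    (a : Fin k → Idx n) :
    actAt p (Matrix.single u v 1) t a = if a p = u then t (Function.update a p v) else 0 := by
  simp [actAt_apply, Matrix.single_apply, ite_and, eq_comm]

/-- The components of the image of a tensor under a product of matrix units acting on distinct
places. -/
lemma prod_actAt_single_apply {n k : ℕ} (t : Tensor n k) : ∀ {r : ℕ} (f : Fin r → Fin k)
    (_ : Function.Injective f) (u v : Fin r → Idx n) (a b : Fin k → Idx n)
    (_ : ∀ m, b (f m) = v m) (_ : ∀ q, (∀ m, q ≠ f m) → b q = a q),
    (List.ofFn fun m => actAt (f m) (Matrix.single (u m) (v m) (1 : ℂ))).prod t a =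
      if ∀ m, a (f m) = u m then t b else 0
  | 0, f, _, u, v, a, b, _, hb => by
    simp [funext fun q => hb q fun m => m.elim0]
  | r + 1, f, hf, u, v, a, b, hv, hb => by
    rw [List.ofFn_succ, List.prod_cons, Module.End.mul_apply, actAt_single_apply,
      prod_actAt_single_apply t (fun m => f m.succ)
        (fun x y h => Fin.succ_injective _ (hf h)) (fun m => u m.succ) (fun m => v m.succ) _ b
        (fun m => hv m.succ) (fun q hq => ?_)]
    · have : ∀ m : Fin r, f m.succ ≠ f 0 := fun m => hf.ne (Fin.succ_ne_zero m)
      simp [Function.update_of_ne (this _), Fin.forall_fin_succ, ite_and]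
    · rcases eq_or_ne q (f 0) with rfl | h
      · simp [hv]
      · rw [Function.update_of_ne h, hb]
        intro m
        induction m using Fin.cases with
        | zero => exact h
        | succ m => exact hq m

/-! ### Signed sums of products of matrix units -/

/-- If two factors act on the same place, the signed sum vanishes: interchanging the column index
of the first of two successive such factors with the row index of the second one
does not change the product. -/
lemma sum_sign_smul_prod_actAt_eq_zero {n k : ℕ} (z : Fin (2 * n) → Idx n) (f : Fin n → Fin k)
    (hf : ¬ Function.Injective f) :
    ∑ π : Perm (Fin (2 * n)), ((Perm.sign π : ℤ) : ℂ) • (List.ofFn fun m : Fin n =>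
      actAt (f m) (Matrix.single (-z (π (pairPos n (m, 0)))) (z (π (pairPos n (m, 1))))
        (1 : ℂ))).prod = 0 := by
  -- For the least `l` whose place occurs before, no factor strictly between `p` and `l` acts on
  -- that place.
  obtain ⟨p, l, hpl, hfpl, hmin⟩ : ∃ p l, p < l ∧ f p = f l ∧
      ∀ m, p < m → m < l → f m ≠ f l := by
    have h : ∃ l, ∃ p, p < l ∧ f p = f l := by
      simp only [Function.Injective, not_forall] at hf
      obtain ⟨x, y, e, hne⟩ := hf
      rcases lt_or_gt_of_ne hne with h | h
      exacts [⟨y, x, h, e⟩, ⟨x, y, h, e.symm⟩]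
    obtain ⟨l, ⟨p, hpl, e⟩, hl⟩ := WellFounded.has_min wellFounded_lt
      {l | ∃ p, p < l ∧ f p = f l} h
    exact ⟨p, l, hpl, e, fun m hpm hml e' => hl m ⟨p, hpm, e.trans e'.symm⟩ hml⟩
  set κ : Perm (Fin (2 * n)) := swap (pairPos n (p, 1)) (pairPos n (l, 0))
  have hne : pairPos n (p, 1) ≠ pairPos n (l, 0) := by simp
  have h := sum_sign_smul_mul_right (fun π : Perm (Fin (2 * n)) => (List.ofFn fun m : Fin n =>
      actAt (k := k) (f m) (Matrix.single (-z (π (pairPos n (m, 0)))) (z (π (pairPos n (m, 1))))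
        (1 : ℂ))).prod) κ
  have h' : ∀ π : Perm (Fin (2 * n)), (List.ofFn fun m : Fin n =>
      actAt (k := k) (f m) (Matrix.single (-z ((π * κ) (pairPos n (m, 0))))
        (z ((π * κ) (pairPos n (m, 1)))) (1 : ℂ))).prod = (List.ofFn fun m : Fin n =>
      actAt (f m) (Matrix.single (-z (π (pairPos n (m, 0)))) (z (π (pairPos n (m, 1))))
        (1 : ℂ))).prod := by
    intro π
    refine prod_actAt_congr f (fun m => Matrix.single (-z ((π * κ) (pairPos n (m, 0))))
        (z ((π * κ) (pairPos n (m, 1)))) (1 : ℂ)) (fun m => Matrix.single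
        (-z (π (pairPos n (m, 0)))) (z (π (pairPos n (m, 1)))) (1 : ℂ)) p l hpl hfpl hmin ?_ ?_
    · have h1 : κ (pairPos n (p, 0)) = pairPos n (p, 0) :=
        swap_apply_of_ne_of_ne (by simp) (by simp [hpl.ne])
      have h2 : κ (pairPos n (l, 1)) = pairPos n (l, 1) :=
        swap_apply_of_ne_of_ne (by simp [hpl.ne']) (by simp)
      have h3 : κ (pairPos n (p, 1)) = pairPos n (l, 0) := swap_apply_left _ _
      have h4 : κ (pairPos n (l, 0)) = pairPos n (p, 1) := swap_apply_right _ _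
      simp only [Perm.mul_apply, h1, h2, h3, h4]
      -- `E_{-i,j} E_{-k,l} = δ_{j,-k} E_{-i,l}` is symmetric in `j` and `k`.
      by_cases e : z (π (pairPos n (l, 0))) = -z (π (pairPos n (p, 1)))
      · rw [e, neg_neg, Matrix.single_mul_single_same, Matrix.single_mul_single_same]
      · rw [Matrix.single_mul_single_of_ne, Matrix.single_mul_single_of_ne]
        · exact fun e' => e (by rw [e', neg_neg])
        · exact e
    · intro m hmp hml
      have h1 : κ (pairPos n (m, 0)) = pairPos n (m, 0) :=
        swap_apply_of_ne_of_ne (by simp) (by simp [hml])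
      have h2 : κ (pairPos n (m, 1)) = pairPos n (m, 1) :=
        swap_apply_of_ne_of_ne (by simp [hmp]) (by simp)
      simp only [Perm.mul_apply, h1, h2]
  rw [Perm.sign_swap hne] at h
  simp only [h'] at h
  have : IsAddTorsionFree (Module.End ℂ (Tensor n k)) :=
    .of_isTorsionFree ℂ _
  refine self_eq_neg.1 (h.trans ?_)
  simp

/-- If the factors act on all places, once each, the signed sum does not depend on their order. -/
lemma sum_sign_smul_prod_actAt_apply {n : ℕ} (z : Fin (2 * n) → Idx n) (f : Perm (Fin n))
    (t : Tensor n n) (a : Fin n → Idx n) :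
    (∑ π : Perm (Fin (2 * n)), ((Perm.sign π : ℤ) : ℂ) • (List.ofFn fun m : Fin n =>
      actAt (f m) (Matrix.single (-z (π (pairPos n (m, 0)))) (z (π (pairPos n (m, 1))))
        (1 : ℂ))).prod) t a =
    ∑ π : Perm (Fin (2 * n)), ((Perm.sign π : ℤ) : ℂ) •
      if ∀ m, a m = -z (π (pairPos n (m, 0))) then t fun m => z (π (pairPos n (m, 1))) else 0 := by
  simp only [LinearMap.sum_apply, Finset.sum_apply, LinearMap.smul_apply, Pi.smul_apply]
  -- The permutation `(m, ε) ↦ (f m, ε)` of the positions has sign `(sgn f)² = 1`.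
  rw [sum_sign_smul_mul_right _ ((pairPos n).permCongr (Equiv.prodCongrLeft fun _ => f)),
    Perm.sign_permCongr, Perm.sign_prodCongrLeft]
  simp only [Fin.prod_univ_two, Units.val_mul, Int.cast_mul, perm_sign_mul_self, one_smul]
  refine Finset.sum_congr rfl fun π _ => ?_
  rw [prod_actAt_single_apply t f f.injective _ _ a (fun m => z (π (pairPos n (m, 1))))]
  · congr 1
    refine if_congr ?_ rfl rfl
    rw [← f.forall_congr_right (q := fun m => a m = -z (π (pairPos n (m, 0))))]
    simp [Equiv.permCongr_apply]
  · intro m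
    simp [Equiv.permCongr_apply]
  · exact fun q hq => absurd (f.apply_symm_apply q).symm (hq _)

/-! ### The action of the Pfaffians -/

lemma repT_apply {n : ℕ} (u : T n) (s : Skew n n) (a : Fin n → Idx n) :
    (repT n u s).1 a = (n.factorial : ℂ)⁻¹ * ∑ b, u.1 (join a b) * s.1 (-b) := rfl

lemma repSkew_apply {n k : ℕ} (X : so n) (s : Skew n k) :
    (repSkew n k X s).1 = act X.1 s.1 := rfl

lemma prod_repSkew_apply {n k r : ℕ} (X : Fin r → so n) (s : Skew n k) :
    ((List.ofFn fun p => repSkew n k (X p)).prod s).1 =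
      (List.ofFn fun p => (act (X p).1 : Module.End ℂ (Tensor n k))).prod s.1 := by
  induction r with
  | zero => simp
  | succ r ih =>
    rw [List.ofFn_succ, List.ofFn_succ, List.prod_cons, List.prod_cons, Module.End.mul_apply,
      Module.End.mul_apply, repSkew_apply, ih fun p => X p.succ]

/-- The action of the tensor `e_{-z_1} ∧ … ∧ e_{-z_{2n}}` in components. -/
lemma repT_wedge_neg_apply {n : ℕ} (z : Fin (2 * n) → Idx n) (s : Skew n n) (a : Fin n → Idx n) :
    (repT n (wedge (-z)) s).1 a = (n.factorial : ℂ)⁻¹ * (((Perm.sign (unshuffle n) : ℤ) : ℂ) *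
      ∑ π : Perm (Fin (2 * n)), ((Perm.sign π : ℤ) : ℂ) *
        if ∀ m, a m = -z (π (pairPos n (m, 0))) then s.1 fun m => z (π (pairPos n (m, 1)))
          else 0) := by
  rw [repT_apply]
  congr 1
  -- In the expansion of the determinant, each permutation allows exactly one list `b`.
  have h1 : ∀ b : Fin n → Idx n, (wedge (-z)).1 (join a b) =
      ∑ π : Perm (Fin (2 * n)), ((Perm.sign π : ℤ) : ℂ) *
        if (∀ m, a m = -z (π (blockPos n (Sum.inl m)))) ∧
          b = fun m => -z (π (blockPos n (Sum.inr m))) then 1 else 0 := by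
    intro b
    rw [wedge_apply, Matrix.det_apply']
    refine Finset.sum_congr rfl fun π _ => ?_
    congr 1
    simp only [Matrix.of_apply, Finset.prod_ite_zero, Finset.prod_const_one]
    refine if_congr ?_ rfl rfl
    simp only [Finset.mem_univ, forall_true_left, Pi.neg_apply]
    rw [← (blockPos n).forall_congr_right
      (q := fun x => -z (π x) = join a b x), Sum.forall]
    simp only [join_blockPos_inl, join_blockPos_inr, funext_iff, eq_comm]
  simp only [h1, Finset.sum_mul]
  rw [Finset.sum_comm]
  have h2 := sum_sign_smul_mul_right (fun π : Perm (Fin (2 * n)) =>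
    if ∀ m, a m = -z (π (blockPos n (Sum.inl m))) then
      s.1 fun m => z (π (blockPos n (Sum.inr m))) else 0) (unshuffle n)
  simp only [Perm.mul_apply, unshuffle_inl, unshuffle_inr, smul_eq_mul] at h2
  rw [← h2]
  refine Finset.sum_congr rfl fun π _ => ?_
  simp only [mul_assoc, ← Finset.mul_sum]
  congr 1
  by_cases ha : ∀ m, a m = -z (π (blockPos n (Sum.inl m)))
  · simp only [ha, implies_true, true_and, if_true, ite_mul, one_mul, zero_mul, Finset.sum_ite_eq',
      Finset.mem_univ]
    exact congrArg s.1 (funext fun m => neg_neg _)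
  · simp [ha]

/-- A signed sum of products of `n` matrix units, acting on tensors with `n` indices: of the
assignments of the factors to the places only the `n!` bijective ones contribute, and they
contribute equally. -/
lemma sum_sign_smul_prod_act_apply {n : ℕ} (z : Fin (2 * n) → Idx n) (t : Tensor n n)
    (a : Fin n → Idx n) :
    (∑ π : Perm (Fin (2 * n)), ((Perm.sign π : ℤ) : ℂ) • (List.ofFn fun m : Fin n =>
      act (Matrix.single (-z (π (pairPos n (m, 0)))) (z (π (pairPos n (m, 1))))
        (1 : ℂ))).prod) t a =
    n.factorial * ∑ π : Perm (Fin (2 * n)), ((Perm.sign π : ℤ) : ℂ) *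
      if ∀ m, a m = -z (π (pairPos n (m, 0))) then t fun m => z (π (pairPos n (m, 1))) else 0 := by
  have h1 : ∑ π : Perm (Fin (2 * n)), ((Perm.sign π : ℤ) : ℂ) • (List.ofFn fun m : Fin n =>
      (act (Matrix.single (-z (π (pairPos n (m, 0)))) (z (π (pairPos n (m, 1)))) (1 : ℂ)) :
        Module.End ℂ (Tensor n n))).prod =
      ∑ f : Fin n → Fin n, ∑ π : Perm (Fin (2 * n)), ((Perm.sign π : ℤ) : ℂ) •
        (List.ofFn fun m : Fin n => actAt (f m) (Matrix.single (-z (π (pairPos n (m, 0))))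
          (z (π (pairPos n (m, 1)))) (1 : ℂ))).prod := by
    rw [Finset.sum_comm]
    refine Finset.sum_congr rfl fun π _ => ?_
    rw [← Finset.smul_sum]
    congr 1
    exact prod_ofFn_sum fun m p => actAt p (Matrix.single (-z (π (pairPos n (m, 0))))
      (z (π (pairPos n (m, 1)))) (1 : ℂ))
  have h2 : ∑ f : Fin n → Fin n, ∑ π : Perm (Fin (2 * n)), ((Perm.sign π : ℤ) : ℂ) •
        (List.ofFn fun m : Fin n => actAt (k := n) (f m) (Matrix.single (-z (π (pairPos n (m, 0))))
          (z (π (pairPos n (m, 1)))) (1 : ℂ))).prod =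
      ∑ f : Perm (Fin n), ∑ π : Perm (Fin (2 * n)), ((Perm.sign π : ℤ) : ℂ) •
        (List.ofFn fun m : Fin n => actAt (f m) (Matrix.single (-z (π (pairPos n (m, 0))))
          (z (π (pairPos n (m, 1)))) (1 : ℂ))).prod := by
    symm
    refine Finset.sum_of_injOn (fun f : Perm (Fin n) => (f : Fin n → Fin n))
      (fun f _ g _ e => Equiv.coe_fn_injective e) (by simp) ?_ (fun _ _ => rfl)
    intro f _ hf
    refine sum_sign_smul_prod_actAt_eq_zero z f fun hi => hf ?_
    exact ⟨Equiv.ofBijective f (Finite.injective_iff_bijective.1 hi), by simp, rfl⟩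
  rw [h1, h2, LinearMap.sum_apply, Finset.sum_apply]
  simp only [sum_sign_smul_prod_actAt_apply, smul_eq_mul]
  rw [Finset.sum_const, Finset.card_univ, Fintype.card_perm, Fintype.card_fin, nsmul_eq_mul]

lemma rhoPf_eq_sum {n : ℕ} (z : Fin (2 * n) → Idx n) :
    rhoPf z = ((2 : ℂ) ^ n * (n.factorial : ℂ))⁻¹ • ∑ π : Perm (Fin (2 * n)),
      ((Perm.sign π : ℤ) : ℂ) • (List.ofFn fun m : Fin n =>
        repSkew n n (F (-z (π (pairPos n (m, 0)))) (z (π (pairPos n (m, 1)))))).prod := by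
  simp only [rhoPf, pfF, pf, repU, map_smul, map_sum, map_list_prod, List.map_ofFn, Matrix.of_apply,
    pairPos_zero, pairPos_one]
  congr 1
  refine Finset.sum_congr rfl fun π _ => ?_
  congr 3
  funext m
  exact UniversalEnvelopingAlgebra.lift_ι_apply ℂ _ _

/-- `Pf F_I` acts on the skew-symmetric tensors with `n` indices as `± n! e_{-I}`, where the sign,
that of a shuffle, depends only on `n`. -/
theorem rhoPf_eq_smul_repT {n : ℕ} (z : Fin (2 * n) → Idx n) :
    rhoPf z = (((Perm.sign (unshuffle n) : ℤ) : ℂ) * (n.factorial : ℂ)) •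
      repT n (wedge (-z)) := by
  refine LinearMap.ext fun s => Subtype.ext (funext fun a => ?_)
  let G (x y : Fin (2 * n)) : Module.End ℂ (Tensor n n) := act (Matrix.single (-z x) (z y) 1)
  have hF : ∀ x y, (act (F (-z x) (z y)).1 : Module.End ℂ (Tensor n n)) = G x y - G y x := by
    intro x y
    refine eq_sub_of_add_eq ?_
    simp only [G, act, ← Finset.sum_add_distrib, ← actAt_add, F, neg_neg, sub_add_cancel]
  have h1 : (rhoPf z s).1 = ((2 : ℂ) ^ n * (n.factorial : ℂ))⁻¹ •
      (∑ π : Perm (Fin (2 * n)), ((Perm.sign π : ℤ) : ℂ) • (List.ofFn fun m : Fin n =>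
        (G (π (pairPos n (m, 0))) (π (pairPos n (m, 1))) -
          G (π (pairPos n (m, 1))) (π (pairPos n (m, 0))))).prod) s.1 := by
    rw [rhoPf_eq_sum]
    simp only [LinearMap.smul_apply, LinearMap.sum_apply, Submodule.coe_smul,
      AddSubmonoidClass.coe_finsetSum, prod_repSkew_apply, hF]
  have hn : (n.factorial : ℂ) ≠ 0 := Nat.cast_ne_zero.2 n.factorial_ne_zero
  rw [h1, sum_sign_smul_prod_antisymm, LinearMap.smul_apply,
    Pi.smul_apply, Pi.smul_apply, sum_sign_smul_prod_act_apply, LinearMap.smul_apply,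
    Submodule.coe_smul, Pi.smul_apply, repT_wedge_neg_apply]
  simp only [smul_eq_mul]
  field_simp
  rw [sq, perm_sign_mul_self, mul_one]

/-! ### Bases of `𝒯` -/

/-- A strictly increasing rearrangement of a list without repetitions. -/
lemma exists_orderEmbedding_comp_perm {n k : ℕ} {c : Fin k → Idx n} (hc : Function.Injective c) :
    ∃ (S : Fin k ↪o Idx n) (π : Perm (Fin k)), c = S ∘ π := by
  have h : (Finset.univ.image c).card = k := by
    rw [Finset.card_image_of_injective _ hc, Finset.card_fin]
  have hm : ∀ x, ∃ y, (Finset.univ.image c).orderEmbOfFin h y = c x := fun x => by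
    have : c x ∈ Set.range ((Finset.univ.image c).orderEmbOfFin h) := by simp
    exact this
  choose g hg using hm
  have hg' : Function.Injective g := fun x y e => hc (by rw [← hg, ← hg, e])
  exact ⟨_, Equiv.ofBijective g (Finite.injective_iff_bijective.1 hg'), funext fun x => (hg x).symm⟩

lemma orderEmbedding_eq_of_comp_perm {n k : ℕ} {S S' : Fin k ↪o Idx n} {π : Perm (Fin k)}
    (h : (S : Fin k → Idx n) = S' ∘ π) : S = S' := by
  have hr := congrArg Set.range h
  rw [EquivLike.range_comp] at hr
  exact OrderEmbedding.range_inj.1 hr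

lemma skew_apply_eq_zero {n k : ℕ} (t : Skew n k) {c : Fin k → Idx n}
    (hc : ¬ Function.Injective c) : t.1 c = 0 := by
  obtain ⟨x, y, e, hne⟩ : ∃ x y, c x = c y ∧ x ≠ y := by simpa [Function.Injective] using hc
  have h := t.2 (swap x y) c
  have : c ∘ swap x y = c := by
    funext w
    rcases eq_or_ne w x with rfl | hx
    · simp [e]
    rcases eq_or_ne w y with rfl | hy
    · simp [e]
    simp [swap_apply_of_ne_of_ne hx hy]
  rw [this, Perm.sign_swap hne] at h
  simpa [self_eq_neg] using h

/-- The expansion of a skew-symmetric tensor in the basis `(e_S)`. -/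
lemma eq_sum_smul_wedge {n k : ℕ} (t : Skew n k) :
    t = ∑ S : Fin k ↪o Idx n, t.1 S • wedge S := by
  refine Subtype.ext (funext fun c => ?_)
  have hs : (∑ S : Fin k ↪o Idx n, t.1 S • wedge S : Skew n k).1 c =
      ∑ S : Fin k ↪o Idx n, t.1 S * (wedge S).1 c := by
    simp [Finset.sum_apply]
  rw [hs]
  -- Both sides are skew-symmetric, so only the strictly increasing list `S` underlying `c` matters.
  by_cases hc : Function.Injective c
  · obtain ⟨S, π, rfl⟩ := exists_orderEmbedding_comp_perm hc
    rw [Finset.sum_eq_single S, (wedge S).2, wedge_apply_self S.injective, mul_one, t.2, mul_comm]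
    · intro S' _ hne
      rw [wedge_apply_eq_zero, mul_zero]
      rintro ⟨π', h⟩
      refine hne (orderEmbedding_eq_of_comp_perm (π := π * π'⁻¹) ?_)
      funext x
      simpa using (congrFun h (π'⁻¹ x)).symm
    · simp
  · rw [skew_apply_eq_zero t hc, Finset.sum_eq_zero]
    exact fun S _ => by rw [skew_apply_eq_zero _ hc, mul_zero]

/-- `⟨e_{-c}, t⟩` is the component `t_c`. -/
lemma form_wedge_neg {n : ℕ} (c : Fin (2 * n) → Idx n) (t : T n) :
    form n (wedge (-c)) t = t.1 c := by
  have h1 : ∑ y, (wedge (-c)).1 y * t.1 (-y) = ∑ _π : Perm (Fin (2 * n)), t.1 c := by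
    by_cases hc : Function.Injective c
    · symm
      have hc' : Function.Injective (-c) := neg_injective.comp hc
      refine Finset.sum_of_injOn (fun π : Perm (Fin (2 * n)) => (-c) ∘ π) ?_ (by simp) ?_ ?_
      · intro π _ π' _ e
        exact Equiv.ext fun p => hc' (congrFun e p)
      · intro y _ hy
        rw [wedge_apply_eq_zero, zero_mul]
        rintro ⟨π, rfl⟩
        exact hy ⟨π, by simp, rfl⟩
      · intro π _
        have e : -((-c) ∘ π) = c ∘ π := by funext x; simp
        rw [e, t.2 π c, (wedge (-c)).2 π (-c), wedge_apply_self hc', mul_one, ← mul_assoc,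
          perm_sign_mul_self, one_mul]
    · rw [skew_apply_eq_zero t hc]
      rw [Finset.sum_const_zero, Finset.sum_eq_zero]
      intro y _
      by_cases hy : ∃ π : Perm (Fin (2 * n)), y = (-c) ∘ π
      · obtain ⟨π, rfl⟩ := hy
        have e : -((-c) ∘ π) = c ∘ π := by funext x; simp
        rw [e, t.2 π c, skew_apply_eq_zero t hc, mul_zero, mul_zero]
      · rw [wedge_apply_eq_zero hy, zero_mul]
  rw [form, h1, Finset.sum_const, Finset.card_univ, Fintype.card_perm, Fintype.card_fin,
    nsmul_eq_mul, inv_mul_cancel_left₀ (Nat.cast_ne_zero.2 (Nat.factorial_ne_zero _))]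

lemma form_sum_smul_left {n : ℕ} {ι : Type*} [Fintype ι] (c : ι → ℂ) (I : ι → T n) (u : T n) :
    form n (∑ s, c s • I s) u = ∑ s, c s * form n (I s) u := by
  simp only [form, AddSubmonoidClass.coe_finsetSum, Submodule.coe_smul, Finset.sum_apply,
    Pi.smul_apply, smul_eq_mul, Finset.sum_mul, Finset.mul_sum]
  rw [Finset.sum_comm]
  exact Finset.sum_congr rfl fun s _ => Finset.sum_congr rfl fun y _ => by ring

/-- The value of a bilinear map on the canonical tensor `∑_s I_s ⊗ I_s^*` of the form does not
depend on the basis: it may be computed in the pair of dual bases `(e_{-S})`, `(e_S)`. -/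
lemma sum_wedge_eq_sum_basis {n : ℕ} {ι M : Type*} [Fintype ι] [DecidableEq ι] [AddCommMonoid M]
    [Module ℂ M] (I : Module.Basis ι ℂ (T n)) (d : ι → T n)
    (hd : ∀ s t, form n (I s) (d t) = if s = t then 1 else 0) (B : T n →ₗ[ℂ] T n →ₗ[ℂ] M) :
    ∑ S : Subsets n, B (wedge (-⇑S)) (wedge S) = ∑ s, B (I s) (d s) := by
  have hx : ∀ x : T n, x = ∑ s, form n x (d s) • I s := fun x => by
    conv_lhs => rw [← I.sum_repr x]
    refine Finset.sum_congr rfl fun s _ => ?_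
    congr 1
    conv_rhs => rw [← I.sum_repr x, form_sum_smul_left]
    simp [hd]
  calc ∑ S : Subsets n, B (wedge (-⇑S)) (wedge S)
      = ∑ S : Subsets n, ∑ s, (d s).1 S • B (I s) (wedge S) := by
        refine Finset.sum_congr rfl fun S _ => ?_
        conv_lhs => rw [hx (wedge (-⇑S))]
        simp [form_wedge_neg]
    _ = ∑ s, B (I s) (d s) := by
        rw [Finset.sum_comm]
        refine Finset.sum_congr rfl fun s _ => ?_
        conv_rhs => rw [eq_sum_smul_wedge (d s)]
        simp

/-! ### Operators on tensor powers -/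

lemma map_update_end_add {W : Type*} [AddCommGroup W] [Module ℂ W] {m : ℕ}
    (f : Fin m → Module.End ℂ W) (i : Fin m) (A B : Module.End ℂ W) :
    PiTensorProduct.map (Function.update f i (A + B)) =
      PiTensorProduct.map (Function.update f i A) + PiTensorProduct.map (Function.update f i B) :=
  PiTensorProduct.map_update_add (R := ℂ) (s := fun _ => W) (t := fun _ => W) f i A B

lemma map_update_end_smul {W : Type*} [AddCommGroup W] [Module ℂ W] {m : ℕ}
    (f : Fin m → Module.End ℂ W) (i : Fin m) (c : ℂ) (A : Module.End ℂ W) :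
    PiTensorProduct.map (Function.update f i (c • A)) =
      c • PiTensorProduct.map (Function.update f i A) :=
  PiTensorProduct.map_update_smul (R := ℂ) (s := fun _ => W) (t := fun _ => W) f i c A

/-- `onPlace` as a linear map. -/
def onPlaceLinear {W : Type*} [AddCommGroup W] [Module ℂ W] {m : ℕ} (i : Fin m) :
    Module.End ℂ W →ₗ[ℂ] Module.End ℂ (⨂[ℂ] _ : Fin m, W) where
  toFun := onPlace i
  map_add' A B := map_update_end_add _ i A B
  map_smul' c A := map_update_end_smul _ i c A

/-- `onPlaces` as a bilinear map. -/
def onPlacesBilinear {W : Type*} [AddCommGroup W] [Module ℂ W] {m : ℕ} {i j : Fin m}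
    (h : i ≠ j) :
    Module.End ℂ W →ₗ[ℂ] Module.End ℂ W →ₗ[ℂ] Module.End ℂ (⨂[ℂ] _ : Fin m, W) :=
  LinearMap.mk₂ ℂ (onPlaces i j)
    (fun A A' B => by
      simp only [onPlaces, Function.update_comm h, map_update_end_add])
    (fun c A B => by
      simp only [onPlaces, Function.update_comm h, map_update_end_smul])
    (fun A B B' => map_update_end_add _ j B B')
    (fun c A B => map_update_end_smul _ j c B)

/-! ### Comparison of the operators -/

/-- The sign in `rhoPf_eq_smul_repT` disappears from all products of two Pfaffians. -/
lemma shuffle_sign_mul_factorial_sq (n : ℕ) :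
    (((Perm.sign (unshuffle n) : ℤ) : ℂ) * (n.factorial : ℂ)) *
      (((Perm.sign (unshuffle n) : ℤ) : ℂ) * (n.factorial : ℂ)) = (n.factorial : ℂ) ^ 2 := by
  rw [mul_mul_mul_comm, perm_sign_mul_self, one_mul, sq]

theorem tauPf_eq {n m : ℕ} {ι : Type*} [Fintype ι] [DecidableEq ι]
    (I : Module.Basis ι ℂ (T n)) (d : ι → T n)
    (hd : ∀ s t, form n (I s) (d t) = if s = t then 1 else 0) {i j : Fin m} (hij : i ≠ j) :
    tauPf n i j = (n.factorial : ℂ) ^ 2 • tau I d i j := by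
  refine Eq.trans ?_ (congrArg _ (sum_wedge_eq_sum_basis I d hd
    ((onPlacesBilinear hij).compl₁₂ (repT n) (repT n))))
  rw [tauPf, Finset.smul_sum]
  refine Finset.sum_congr rfl fun S _ => ?_
  change onPlacesBilinear hij _ _ = _
  rw [rhoPf_eq_smul_repT, rhoPf_eq_smul_repT, neg_neg]
  simp only [map_smul, LinearMap.smul_apply, smul_smul, shuffle_sign_mul_factorial_sq,
    LinearMap.compl₁₂_apply]

theorem muPf_eq {n m : ℕ} {ι : Type*} [Fintype ι] [DecidableEq ι]
    (I : Module.Basis ι ℂ (T n)) (d : ι → T n)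
    (hd : ∀ s t, form n (I s) (d t) = if s = t then 1 else 0) {i j : Fin m} (hij : i ≠ j) :
    muPf n i j = (n.factorial : ℂ) ^ 2 • mu I d i j := by
  refine Eq.trans ?_ (congrArg _ (sum_wedge_eq_sum_basis I d hd
    ((onPlacesBilinear hij).compl₁₂ (repT n) (repT n ∘ₗ invol n))))
  rw [muPf, Finset.smul_sum]
  refine Finset.sum_congr rfl fun S _ => ?_
  change onPlacesBilinear hij _ _ = _
  rw [rhoPf_eq_smul_repT]
  simp only [map_smul, LinearMap.smul_apply, smul_smul, shuffle_sign_mul_factorial_sq,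
    LinearMap.compl₁₂_apply, LinearMap.comp_apply, invol_wedge]

theorem nuPf_eq {n m : ℕ} {ι : Type*} [Fintype ι] [DecidableEq ι]
    (I : Module.Basis ι ℂ (T n)) (d : ι → T n)
    (hd : ∀ s t, form n (I s) (d t) = if s = t then 1 else 0) (i : Fin m) :
    nuPf n i = (n.factorial : ℂ) ^ 2 • nu I d i := by
  rw [nuPf, nu, smul_comm]
  congr 1
  refine Eq.trans ?_ (congrArg _ (sum_wedge_eq_sum_basis I d hd
    (((LinearMap.mul ℂ (Module.End ℂ (Skew n n))).compl₁₂ (repT n) (repT n ∘ₗ invol n) +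
      (LinearMap.mul ℂ (Module.End ℂ (Skew n n))).compl₁₂ (repT n) (repT n)).compr₂
        (onPlaceLinear (m := m) i))))
  rw [Finset.smul_sum]
  refine Finset.sum_congr rfl fun S _ => ?_
  rw [map_add, map_mul, map_mul]
  change onPlaceLinear i (rhoPf S * rhoPf (-⇑S) + rhoPf S * rhoPf S) = _
  -- The Pfaffian products occur in the order opposite to that of `nu`.
  rw [rhoPf_eq_smul_repT, rhoPf_eq_smul_repT, neg_neg, add_comm]
  simp only [smul_mul_smul_comm, shuffle_sign_mul_factorial_sq, ← smul_add, map_smul]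
  simp [invol_wedge]

end KZPfaffian

end

theorem mainTheorem2 (n m : ℕ) {ι : Type*} [Fintype ι] [DecidableEq ι]
    (I : Module.Basis ι ℂ (KZPfaffian.T n)) (d : ι → KZPfaffian.T n)
    (hd : ∀ s t, KZPfaffian.form n (I s) (d t) = if s = t then 1 else 0) :
    (∀ i j : Fin m, i ≠ j →
      KZPfaffian.tauPf n i j = (n.factorial : ℂ) ^ 2 • KZPfaffian.tau I d i j ∧
      KZPfaffian.muPf n i j = (n.factorial : ℂ) ^ 2 • KZPfaffian.mu I d i j) ∧
    ∀ i : Fin m, KZPfaffian.nuPf n i = (n.factorial : ℂ) ^ 2 • KZPfaffian.nu I d i :=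
  ⟨fun _ _ hij => ⟨KZPfaffian.tauPf_eq I d hd hij, KZPfaffian.muPf_eq I d hd hij⟩,
    fun i => KZPfaffian.nuPf_eq I d hd i⟩
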